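/- Let $[n]=\{1,\dots,n\}$ with its usual order; an interval of $[n]$ is a nonempty set of consecutive elements. For a graph $H=([n],E)$ and nonempty $C,D\subseteq[n]$ let $d(C,D)=e(C,D)/(|C||D|)$, where $e(C,D)$ is the number of pairs $(u,v)\in C\times D$ with $u$ and $v$ adjacent in $H$. For each $\varepsilon>0$ and $p\in\mathbb{N}$ there exists $k_{p,\varepsilon}\in\mathbb{N}$ such that for each $n\ge 1$, each (finite simple) graph $H=([n],E)$ and each partition $P$ of $[n]$ into intervals with $|P|\le p$, $P$ has a refinement to a partition $Q$ of $[n]$ into at most $k_{p,\varepsilon}$ intervals such that all intervals in $Q$ have the same size, except for some of them that together cover at most $\varepsilon n$ vertices, and such that $$\sum_{A,B\in Q}\ \max_{\substack{I\subseteq A,\ J\subseteq B\\ I,J\text{ intervals}}}|I||J|\,|d(I,J)-d(A,B)|<\varepsilon n^2 ,$$ where the sum ranges over all ordered pairs $(A,B)\in Q\times Q$, including $A=B$. -/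

import Mathlib

/-- `I` is a (nonempty) interval of the linearly ordered vertex set `Fin n`. -/
def IsVertexInterval {n : ℕ} (I : Finset (Fin n)) : Prop :=
  I.Nonempty ∧ (I : Set (Fin n)).OrdConnected

/-- A partition of `Fin n` all of whose classes are intervals. -/
def IsIntervalPartition {n : ℕ} (P : Finpartition (Finset.univ : Finset (Fin n))) : Prop :=
  ∀ A ∈ P.parts, IsVertexInterval A

/-- All classes of the partition have the same cardinality, except for some classes that together
cover at most `ε * n` elements. -/
def IsEpsBalanced {n : ℕ} (ε : ℝ) (Q : Finpartition (Finset.univ : Finset (Fin n))) : Prop :=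
  ∃ E : Finset (Finset (Fin n)), E ⊆ Q.parts ∧
    (∀ A ∈ Q.parts \ E, ∀ B ∈ Q.parts \ E, A.card = B.card) ∧
    ((E.biUnion id).card : ℝ) ≤ ε * n

/-- The values `|I| |J| |d(I,J) - d(A,B)|`, for intervals `I ⊆ A` and `J ⊆ B`. Here
`d(I,J) = e(I,J) / (|I| |J|)`, with `e(I,J)` the number of pairs in `I × J` that are adjacent. -/
def intervalDeviations {n : ℕ} (G : SimpleGraph (Fin n)) [DecidableRel G.Adj]
    (A B : Finset (Fin n)) : Set ℝ :=
  {x | ∃ I J : Finset (Fin n), I ⊆ A ∧ J ⊆ B ∧ IsVertexInterval I ∧ IsVertexInterval J ∧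
    x = (I.card : ℝ) * (J.card : ℝ) *
      |(G.edgeDensity I J : ℝ) - (G.edgeDensity A B : ℝ)|}

/-- The maximum of `|I| |J| |d(I,J) - d(A,B)|` over intervals `I ⊆ A` and `J ⊆ B`. -/
noncomputable def maxIntervalDeviation {n : ℕ} (G : SimpleGraph (Fin n)) [DecidableRel G.Adj]
    (A B : Finset (Fin n)) : ℝ :=
  sSup (intervalDeviations G A B)

/-- For nonempty `A` and `B` the supremum is a genuine maximum. -/
theorem isGreatest_maxIntervalDeviation {n : ℕ} (G : SimpleGraph (Fin n)) [DecidableRel G.Adj]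
    {A B : Finset (Fin n)} (hA : A.Nonempty) (hB : B.Nonempty) :
    IsGreatest (intervalDeviations G A B) (maxIntervalDeviation G A B) := by
  have hfin : (intervalDeviations G A B).Finite := by
    refine (Set.finite_range (fun q : Finset (Fin n) × Finset (Fin n) =>
      (q.1.card : ℝ) * (q.2.card : ℝ) *
        |(G.edgeDensity q.1 q.2 : ℝ) - (G.edgeDensity A B : ℝ)|)).subset ?_
    rintro x ⟨I, J, -, -, -, -, rfl⟩
    exact ⟨(I, J), rfl⟩
  have hne : (intervalDeviations G A B).Nonempty := by
    obtain ⟨a, ha⟩ := hA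
    obtain ⟨b, hb⟩ := hB
    refine ⟨_, {a}, {b}, by simpa using ha, by simpa using hb, ⟨by simp, ?_⟩, ⟨by simp, ?_⟩, rfl⟩
    · rw [Finset.coe_singleton]; exact Set.ordConnected_singleton
    · rw [Finset.coe_singleton]; exact Set.ordConnected_singleton
  exact ⟨hne.csSup_mem hfin, fun x hx => le_csSup hfin.bddAbove hx⟩

/-!
Refine `P` again and again, cutting every class `A` into consecutive blocks of a common length, so
short that the leftover blocks, one per class, are negligible. The squared `ℓ²`-norm of the
average of the adjacency matrix over the products `A × B` of two classes increases along the
refinements and is at most `n ^ 2`, so some partition `Q` and its refinement `R` have nearly the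
same energy; by Pythagoras and Cauchy–Schwarz, the averages over `Q` and over `R` are then close
in `ℓ¹`. An interval `I` inside a class of `Q` is a union of blocks of `R` up to its two end
blocks, so on a product `I × J` of such intervals the edges are counted by the average over `R`,
hence, up to the `ℓ¹`-error, by the density `d(A, B)`.
-/

open Finset
open scoped BigOperators

section Average

variable {α : Type*} [DecidableEq α] {s S A : Finset α} {P Q : Finpartition s} {f : α → ℝ}
  {M η : ℝ}

theorem sum_parts_sum (P : Finpartition s) (g : α → ℝ) :
    ∑ A ∈ P.parts, ∑ a ∈ A, g a = ∑ a ∈ s, g a := by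
  simpa only [P.biUnion_parts, id] using (sum_biUnion (f := g) P.disjoint).symm

/-- The conditional expectation of `f` with respect to the partition `P`: on each class of `P`, the
function `f` is replaced by its mean over that class. -/
noncomputable def partAverage (P : Finpartition s) (f : α → ℝ) (a : α) : ℝ :=
  𝔼 b ∈ P.part a, f b

/-- The energy of `P` with respect to `f`: the squared `ℓ²`-norm of the conditional expectation. -/
noncomputable def partEnergy (P : Finpartition s) (f : α → ℝ) : ℝ :=
  ∑ a ∈ s, partAverage P f a ^ 2

theorem partAverage_eq_expect (f : α → ℝ) (hA : A ∈ P.parts) {a : α} (ha : a ∈ A) :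
    partAverage P f a = 𝔼 b ∈ A, f b := by
  rw [partAverage, P.part_eq_of_mem hA ha]

theorem sum_partAverage_mem_parts (f : α → ℝ) (hA : A ∈ P.parts) :
    ∑ a ∈ A, partAverage P f a = ∑ a ∈ A, f a := by
  rw [sum_congr rfl fun _ => partAverage_eq_expect f hA, sum_const, card_smul_expect]

theorem biUnion_parts_filter_subset (hSs : S ⊆ s) (hS : ∀ a ∈ S, P.part a ⊆ S) :
    {A ∈ P.parts | A ⊆ S}.biUnion id = S := by
  refine Subset.antisymm (biUnion_subset.2 fun A hA => (mem_filter.1 hA).2) fun a ha => ?_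
  exact mem_biUnion.2
    ⟨P.part a, mem_filter.2 ⟨P.part_mem.2 (hSs ha), hS a ha⟩, P.mem_part (hSs ha)⟩

theorem sum_partAverage_of_part_subset (f : α → ℝ) (hSs : S ⊆ s) (hS : ∀ a ∈ S, P.part a ⊆ S) :
    ∑ a ∈ S, partAverage P f a = ∑ a ∈ S, f a := by
  have hdisj : (({A ∈ P.parts | A ⊆ S} : Finset (Finset α)) : Set (Finset α)).PairwiseDisjoint id :=
    P.disjoint.subset (coe_subset.2 (filter_subset _ _))
  rw [← biUnion_parts_filter_subset hSs hS, sum_biUnion hdisj, sum_biUnion hdisj]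
  exact sum_congr rfl fun A hA => sum_partAverage_mem_parts f (mem_filter.1 hA).1

theorem part_subset_of_le (hQP : Q ≤ P) (hA : A ∈ P.parts) {a : α} (ha : a ∈ A) :
    Q.part a ⊆ A := by
  have has : a ∈ s := P.subset hA ha
  obtain ⟨B, hB, hsub⟩ := hQP (Q.part_mem.2 has)
  rwa [P.eq_of_mem_parts hA hB ha (hsub (Q.mem_part has))]

theorem sum_partAverage_mul_partAverage (hQP : Q ≤ P) (f : α → ℝ) :
    ∑ a ∈ s, partAverage Q f a * partAverage P f a = partEnergy P f := by
  rw [partEnergy, ← sum_parts_sum P, ← sum_parts_sum P]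
  refine sum_congr rfl fun A hA => ?_
  calc ∑ a ∈ A, partAverage Q f a * partAverage P f a
      = (∑ a ∈ A, partAverage Q f a) * 𝔼 b ∈ A, f b := by
        rw [sum_mul]
        exact sum_congr rfl fun a ha => by rw [partAverage_eq_expect f hA ha]
    _ = (∑ a ∈ A, partAverage P f a) * 𝔼 b ∈ A, f b := by
        rw [sum_partAverage_mem_parts f hA,
          sum_partAverage_of_part_subset f (P.subset hA) fun a => part_subset_of_le hQP hA]
    _ = ∑ a ∈ A, partAverage P f a ^ 2 := by
        rw [sum_mul]
        exact sum_congr rfl fun a ha => by rw [sq, partAverage_eq_expect f hA ha]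

theorem sum_sq_partAverage_sub (hQP : Q ≤ P) (f : α → ℝ) :
    ∑ a ∈ s, (partAverage Q f a - partAverage P f a) ^ 2 = partEnergy Q f - partEnergy P f := by
  simp only [sub_sq, sum_add_distrib, sum_sub_distrib, mul_assoc, ← mul_sum,
    sum_partAverage_mul_partAverage hQP, partEnergy]
  ring

theorem partEnergy_nonneg (P : Finpartition s) (f : α → ℝ) : 0 ≤ partEnergy P f :=
  sum_nonneg fun _ _ => sq_nonneg _

theorem abs_partAverage_le (P : Finpartition s) (hf : ∀ a ∈ s, |f a| ≤ M) {a : α} (ha : a ∈ s) :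
    |partAverage P f a| ≤ M :=
  (abs_expect_le _ _).trans
    (expect_le (P.part_nonempty.2 ha) fun b hb => hf b (P.part_subset a hb))

theorem partEnergy_le (P : Finpartition s) (hf : ∀ a ∈ s, |f a| ≤ M) :
    partEnergy P f ≤ #s * M ^ 2 := by
  rw [← nsmul_eq_mul]
  exact sum_le_card_nsmul _ _ _ fun a ha =>
    sq_le_sq' (abs_le.1 (abs_partAverage_le P hf ha)).1 (abs_le.1 (abs_partAverage_le P hf ha)).2

theorem sum_abs_partAverage_sub_le (hQP : Q ≤ P) (hη : 0 ≤ η)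
    (h : partEnergy Q f - partEnergy P f ≤ η ^ 2 * #s) :
    ∑ a ∈ s, |partAverage Q f a - partAverage P f a| ≤ η * #s := by
  refine le_of_abs_le (abs_le_of_sq_le_sq ?_ (by positivity))
  calc (∑ a ∈ s, |partAverage Q f a - partAverage P f a|) ^ 2
      ≤ #s * ∑ a ∈ s, |partAverage Q f a - partAverage P f a| ^ 2 := sq_sum_le_card_mul_sum_sq
    _ = #s * (partEnergy Q f - partEnergy P f) := by
        simp only [sq_abs, sum_sq_partAverage_sub hQP]
    _ ≤ #s * (η ^ 2 * #s) := by gcongr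
    _ = (η * #s) ^ 2 := by ring

theorem abs_sum_sub_partAverage_le (P : Finpartition s) (hf : ∀ a ∈ s, |f a| ≤ M) (hS : S ⊆ s) :
    |∑ a ∈ S, (f a - partAverage P f a)| ≤ 2 * M * #{a ∈ S | ¬ P.part a ⊆ S} := by
  have hinterior : ∑ a ∈ S with P.part a ⊆ S, (f a - partAverage P f a) = 0 := by
    rw [sum_sub_distrib, sub_eq_zero]
    refine (sum_partAverage_of_part_subset f ((filter_subset _ _).trans hS)
      fun a ha b hb => ?_).symm
    have hba : P.part b = P.part a := P.part_eq_of_mem (P.part_mem.2 (hS (mem_filter.1 ha).1)) hb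
    exact mem_filter.2 ⟨(mem_filter.1 ha).2 hb, hba ▸ (mem_filter.1 ha).2⟩
  rw [← sum_filter_add_sum_filter_not S (fun a => P.part a ⊆ S), hinterior, zero_add, mul_comm,
    ← nsmul_eq_mul]
  refine (abs_sum_le_sum_abs _ _).trans (sum_le_card_nsmul _ _ _ fun a ha => ?_)
  have has : a ∈ s := hS (mem_filter.1 ha).1
  linarith [abs_sub (f a) (partAverage P f a), hf a has, abs_partAverage_le P hf has]

theorem card_mul_abs_expect_sub_expect_le (Q : Finpartition s) (hf : ∀ a ∈ s, |f a| ≤ M)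
    (hA : A ∈ P.parts) (hSA : S ⊆ A) :
    #S * |𝔼 a ∈ S, f a - 𝔼 a ∈ A, f a| ≤
      ∑ a ∈ A, |partAverage Q f a - partAverage P f a| + 2 * M * #{a ∈ S | ¬ Q.part a ⊆ S} := by
  have hsplit : #S * (𝔼 a ∈ S, f a - 𝔼 a ∈ A, f a) =
      ∑ a ∈ S, (partAverage Q f a - partAverage P f a) + ∑ a ∈ S, (f a - partAverage Q f a) := by
    rw [mul_sub, card_mul_expect, ← nsmul_eq_mul, ← sum_const,
      ← sum_congr rfl fun a ha => partAverage_eq_expect f hA (hSA ha), ← sum_sub_distrib,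
      ← sum_add_distrib]
    exact sum_congr rfl fun a _ => by ring
  rw [← abs_of_nonneg (Nat.cast_nonneg (α := ℝ) #S), ← abs_mul, hsplit]
  refine (abs_add_le _ _).trans
    (add_le_add ?_ (abs_sum_sub_partAverage_le Q hf (hSA.trans (P.subset hA))))
  exact (abs_sum_le_sum_abs _ _).trans
    (sum_le_sum_of_subset_of_nonneg hSA fun _ _ _ => abs_nonneg _)

end Average

section Product

variable {α β : Type*} [DecidableEq α] [DecidableEq β] {s : Finset α} {t : Finset β}

/-- The partition of `s ×ˢ t` into the products of a class of `P` with a class of `Q`. -/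
def productPartition (P : Finpartition s) (Q : Finpartition t) : Finpartition (s ×ˢ t) :=
  Finpartition.ofExistsUnique ((P.parts ×ˢ Q.parts).image fun C => C.1 ×ˢ C.2)
    (by
      simp only [mem_image, mem_product]
      rintro _ ⟨C, ⟨hA, hB⟩, rfl⟩
      exact product_subset_product (P.subset hA) (Q.subset hB))
    (by
      rintro ⟨a, b⟩ hab
      obtain ⟨ha, hb⟩ := mem_product.1 hab
      refine ⟨P.part a ×ˢ Q.part b, ⟨mem_image.2 ⟨(P.part a, Q.part b), by simp [ha, hb], rfl⟩,
        mem_product.2 ⟨P.mem_part ha, Q.mem_part hb⟩⟩, ?_⟩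
      rintro T ⟨hT, habT⟩
      obtain ⟨C, hC, rfl⟩ := mem_image.1 hT
      rw [P.part_eq_of_mem (mem_product.1 hC).1 (mem_product.1 habT).1,
        Q.part_eq_of_mem (mem_product.1 hC).2 (mem_product.1 habT).2])
    (by
      rw [mem_image]
      rintro ⟨C, hC, h⟩
      exact ((P.nonempty_of_mem_parts (mem_product.1 hC).1).product
        (Q.nonempty_of_mem_parts (mem_product.1 hC).2)).ne_empty h)

variable {P P' : Finpartition s} {Q Q' : Finpartition t}

theorem mem_parts_productPartition {C : Finset (α × β)} :
    C ∈ (productPartition P Q).parts ↔ ∃ A ∈ P.parts, ∃ B ∈ Q.parts, A ×ˢ B = C := by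
  simp [productPartition, and_assoc]

theorem product_mem_parts_productPartition {A : Finset α} {B : Finset β} (hA : A ∈ P.parts)
    (hB : B ∈ Q.parts) : A ×ˢ B ∈ (productPartition P Q).parts :=
  mem_parts_productPartition.2 ⟨A, hA, B, hB, rfl⟩

theorem part_productPartition {a : α} {b : β} (ha : a ∈ s) (hb : b ∈ t) :
    (productPartition P Q).part (a, b) = P.part a ×ˢ Q.part b :=
  (productPartition P Q).part_eq_of_mem
    (product_mem_parts_productPartition (P.part_mem.2 ha) (Q.part_mem.2 hb))
    (mem_product.2 ⟨P.mem_part ha, Q.mem_part hb⟩)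

theorem productPartition_mono (hP : P' ≤ P) (hQ : Q' ≤ Q) :
    productPartition P' Q' ≤ productPartition P Q := by
  intro C hC
  obtain ⟨A', hA', B', hB', rfl⟩ := mem_parts_productPartition.1 hC
  obtain ⟨A, hA, hAA'⟩ := hP hA'
  obtain ⟨B, hB, hBB'⟩ := hQ hB'
  exact ⟨A ×ˢ B, product_mem_parts_productPartition hA hB, product_subset_product hAA' hBB'⟩

theorem sum_parts_sum_parts_sum_product (P : Finpartition s) (Q : Finpartition t)
    (g : α × β → ℝ) :
    ∑ A ∈ P.parts, ∑ B ∈ Q.parts, ∑ e ∈ A ×ˢ B, g e = ∑ e ∈ s ×ˢ t, g e := by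
  simp only [sum_product]
  rw [← sum_parts_sum P]
  refine sum_congr rfl fun A _ => ?_
  rw [sum_comm]
  exact sum_congr rfl fun a _ => sum_parts_sum Q fun b => g (a, b)

theorem card_filter_not_part_productPartition_subset_le (P : Finpartition s) (Q : Finpartition t)
    {I : Finset α} {J : Finset β} (hI : I ⊆ s) (hJ : J ⊆ t) :
    #{e ∈ I ×ˢ J | ¬ (productPartition P Q).part e ⊆ I ×ˢ J} ≤
      #{a ∈ I | ¬ P.part a ⊆ I} * #J + #I * #{b ∈ J | ¬ Q.part b ⊆ J} := by
  rw [← card_product, ← card_product]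
  refine (card_le_card ?_).trans (card_union_le _ _)
  rintro ⟨a, b⟩ he
  obtain ⟨hab, hnot⟩ := mem_filter.1 he
  obtain ⟨ha, hb⟩ := mem_product.1 hab
  rw [part_productPartition (hI ha) (hJ hb)] at hnot
  have : ¬ P.part a ⊆ I ∨ ¬ Q.part b ⊆ J :=
    not_and_or.1 fun h => hnot (product_subset_product h.1 h.2)
  simpa [ha, hb] using this

end Product

section Chop

variable {α : Type*} [LinearOrder α] {s : Finset α}

/-- The number of elements of `s` below `a`, which for `a ∈ s` is the position of `a` in `s`,
counted from `0`. -/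
def rankIn (s : Finset α) (a : α) : ℕ := #{b ∈ s | b < a}

theorem rankIn_mono (s : Finset α) : Monotone (rankIn s) := fun _ _ h =>
  card_le_card (monotone_filter_right _ fun _ _ hb => hb.trans_le h)

theorem rankIn_lt_rankIn {a b : α} (ha : a ∈ s) (hab : a < b) : rankIn s a < rankIn s b :=
  card_lt_card ((ssubset_iff_of_subset
    (monotone_filter_right _ fun _ _ hc => hc.trans hab)).2 ⟨a, by simp [ha, hab], by simp⟩)

theorem rankIn_injOn (s : Finset α) : Set.InjOn (rankIn s) s :=
  StrictMonoOn.injOn fun _ ha _ _ => rankIn_lt_rankIn ha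

theorem rankIn_lt_card {a : α} (ha : a ∈ s) : rankIn s a < #s :=
  card_lt_card ((ssubset_iff_of_subset (filter_subset _ _)).2 ⟨a, ha, by simp⟩)

theorem image_rankIn (s : Finset α) : s.image (rankIn s) = range #s := by
  refine eq_of_subset_of_card_le (image_subset_iff.2 fun a ha => mem_range.2 (rankIn_lt_card ha)) ?_
  rw [card_range, card_image_of_injOn (rankIn_injOn s)]

/-- The `q`-th block, counted from `0`, when `s` is cut in increasing order into blocks of `m`
elements. -/
def chopPiece (s : Finset α) (m q : ℕ) : Finset α := {a ∈ s | rankIn s a / m = q}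

theorem card_chopPiece (s : Finset α) {m : ℕ} (hm : 0 < m) (q : ℕ) :
    #(chopPiece s m q) = min m (#s - q * m) := by
  have hrank : {r ∈ range #s | r / m = q} = Ico (q * m) (min (q * m + m) #s) := by
    ext r
    rw [mem_filter, mem_range, mem_Ico, Nat.div_eq_iff hm]
    omega
  rw [chopPiece, ← card_image_of_injOn ((rankIn_injOn s).mono (coe_subset.2 (filter_subset _ _))),
    ← filter_image (p := (· / m = q)), image_rankIn, hrank, Nat.card_Ico]
  omega

theorem ordConnected_chopPiece (hs : (s : Set α).OrdConnected) (m q : ℕ) :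
    (chopPiece s m q : Set α).OrdConnected := by
  refine ⟨fun a ha c hc b hb => ?_⟩
  obtain ⟨has, haq⟩ := mem_filter.1 ha
  obtain ⟨hcs, hcq⟩ := mem_filter.1 hc
  refine mem_filter.2 ⟨hs.out has hcs hb, le_antisymm ?_ ?_⟩
  · exact hcq ▸ Nat.div_le_div_right (rankIn_mono s hb.2)
  · exact haq ▸ Nat.div_le_div_right (rankIn_mono s hb.1)

/-- The partition of `s` into consecutive blocks of `m` elements and one possible shorter block of
the largest elements. For `m = 0`, where the quotients by `m` are `0`, it has at most one class. -/
def chop (s : Finset α) (m : ℕ) : Finpartition s :=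
  Finpartition.ofErase ((range (#s / m + 1)).image (chopPiece s m))
    (by
      rw [supIndep_iff_pairwiseDisjoint]
      intro C hC D hD hCD
      obtain ⟨q, -, rfl⟩ := mem_image.1 hC
      obtain ⟨r, -, rfl⟩ := mem_image.1 hD
      exact disjoint_filter.2 fun a _ hq hr => hCD (by rw [← hq, ← hr]))
    (by
      ext a
      simp only [mem_sup, mem_image, exists_exists_and_eq_and, id, chopPiece, mem_filter]
      refine ⟨fun ⟨_, _, has, _⟩ => has, fun has => ⟨_, mem_range.2 ?_, has, rfl⟩⟩
      exact Nat.lt_succ_of_le (Nat.div_le_div_right (rankIn_lt_card has).le))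

theorem exists_chopPiece_eq_of_mem_parts_chop {m : ℕ} {C : Finset α} (hC : C ∈ (chop s m).parts) :
    ∃ q ≤ #s / m, chopPiece s m q = C := by
  obtain ⟨q, hq, rfl⟩ := mem_image.1 (mem_of_mem_erase hC)
  exact ⟨q, Nat.lt_succ_iff.1 (mem_range.1 hq), rfl⟩

theorem card_parts_chop_le (s : Finset α) (m : ℕ) : #(chop s m).parts ≤ #s / m + 1 :=
  (card_le_card (erase_subset _ _)).trans (card_image_le.trans_eq (card_range _))

theorem eq_chopPiece_of_card_ne {m : ℕ} (hm : 0 < m) {C : Finset α} (hC : C ∈ (chop s m).parts)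
    (hCm : #C ≠ m) : C = chopPiece s m (#s / m) := by
  obtain ⟨q, hq, rfl⟩ := exists_chopPiece_eq_of_mem_parts_chop hC
  rcases hq.eq_or_lt with rfl | hlt
  · rfl
  · refine absurd ?_ hCm
    have : (q + 1) * m ≤ #s := (Nat.mul_le_mul_right m hlt).trans (Nat.div_mul_le_self _ _)
    rw [card_chopPiece s hm, min_eq_left]
    rw [Nat.succ_mul] at this
    omega

/-- The refinement of `Q` in which each class is cut by `chop` into blocks of `m` elements. -/
def chopParts (Q : Finpartition s) (m : ℕ) : Finpartition s := Q.bind fun A _ => chop A m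

variable {Q : Finpartition s} {m : ℕ} {C : Finset α}

theorem mem_parts_chopParts :
    C ∈ (chopParts Q m).parts ↔ ∃ A ∈ Q.parts, C ∈ (chop A m).parts := by
  simp only [chopParts, Finpartition.mem_bind, exists_prop]

theorem chopParts_le (Q : Finpartition s) (m : ℕ) : chopParts Q m ≤ Q := by
  intro C hC
  obtain ⟨A, hA, hCA⟩ := mem_parts_chopParts.1 hC
  exact ⟨A, hA, (chop A m).subset hCA⟩

theorem card_parts_chopParts_le (Q : Finpartition s) (m : ℕ) :
    #(chopParts Q m).parts ≤ #s / m + #Q.parts := by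
  have hdiv : ∑ A ∈ Q.parts, #A / m ≤ #s / m := by
    rcases m.eq_zero_or_pos with rfl | hm
    · simp
    · rw [Nat.le_div_iff_mul_le hm, sum_mul, ← Q.sum_card_parts]
      exact sum_le_sum fun A _ => Nat.div_mul_le_self _ _
  calc #(chopParts Q m).parts = ∑ A ∈ Q.parts, #(chop A m).parts := by
        rw [chopParts, Finpartition.card_bind, sum_attach Q.parts fun A => #(chop A m).parts]
    _ ≤ ∑ A ∈ Q.parts, (#A / m + 1) := sum_le_sum fun A _ => card_parts_chop_le A m
    _ ≤ #s / m + #Q.parts := by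
        rw [sum_add_distrib, sum_const, smul_eq_mul, mul_one]
        gcongr

theorem card_le_of_mem_parts_chopParts (hm : 0 < m) (hC : C ∈ (chopParts Q m).parts) :
    #C ≤ m := by
  obtain ⟨A, -, hCA⟩ := mem_parts_chopParts.1 hC
  obtain ⟨q, -, rfl⟩ := exists_chopPiece_eq_of_mem_parts_chop hCA
  exact (card_chopPiece A hm q).trans_le (min_le_left _ _)

theorem ordConnected_of_mem_parts_chopParts (hQ : ∀ A ∈ Q.parts, (A : Set α).OrdConnected)
    (hC : C ∈ (chopParts Q m).parts) : (C : Set α).OrdConnected := by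
  obtain ⟨A, hA, hCA⟩ := mem_parts_chopParts.1 hC
  obtain ⟨q, -, rfl⟩ := exists_chopPiece_eq_of_mem_parts_chop hCA
  exact ordConnected_chopPiece (hQ A hA) m q

theorem card_biUnion_filter_card_ne_chopParts_le (Q : Finpartition s) (hm : 0 < m) :
    #({C ∈ (chopParts Q m).parts | #C ≠ m}.biUnion id) ≤ #Q.parts * m := by
  have hsub : {C ∈ (chopParts Q m).parts | #C ≠ m}.biUnion id ⊆
      Q.parts.biUnion fun A => chopPiece A m (#A / m) := by
    refine biUnion_subset.2 fun C hC => ?_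
    obtain ⟨hC, hCm⟩ := mem_filter.1 hC
    obtain ⟨A, hA, hCA⟩ := mem_parts_chopParts.1 hC
    rw [id, eq_chopPiece_of_card_ne hm hCA hCm]
    exact subset_biUnion_of_mem (fun A => chopPiece A m (#A / m)) hA
  exact (card_le_card hsub).trans (card_biUnion_le_card_mul _ _ _ fun A _ =>
    (card_chopPiece A hm _).trans_le (min_le_left _ _))

/-- The block length used to refine `Q`: the shorter blocks, one per class of `Q`, then cover at
most the proportion `1 / D` of `s`. -/
def chopSize (D : ℕ) (Q : Finpartition s) : ℕ := #s / (D * #Q.parts)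

theorem card_parts_mul_chopSize_mul_le (D : ℕ) (Q : Finpartition s) :
    #Q.parts * chopSize D Q * D ≤ #s := by
  rw [chopSize, mul_right_comm, mul_comm #Q.parts, mul_comm]
  exact Nat.div_mul_le_self _ _

theorem div_div_self_le_two_mul (N x : ℕ) : N / (N / x) ≤ 2 * x := by
  rcases (N / x).eq_zero_or_pos with h | h
  · simp [h]
  · have hx : 0 < x := Nat.pos_of_ne_zero fun hx => by simp [hx] at h
    refine Nat.div_le_of_le_mul ?_
    nlinarith [Nat.lt_div_mul_add (a := N) hx]

theorem card_parts_chopParts_chopSize_le (D : ℕ) (Q : Finpartition s) :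
    #(chopParts Q (chopSize D Q)).parts ≤ (2 * D + 1) * #Q.parts :=
  calc #(chopParts Q (chopSize D Q)).parts ≤ #s / chopSize D Q + #Q.parts :=
        card_parts_chopParts_le Q _
    _ ≤ 2 * (D * #Q.parts) + #Q.parts := by gcongr; exact div_div_self_le_two_mul _ _
    _ = (2 * D + 1) * #Q.parts := by ring

/-- The `t`-fold iteration of refining `Q` to `chopParts Q (chopSize D Q)`, started at `P`. -/
def iterChop (D : ℕ) (P : Finpartition s) : ℕ → Finpartition s
  | 0 => P
  | t + 1 => chopParts (iterChop D P t) (chopSize D (iterChop D P t))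

theorem iterChop_le (D : ℕ) (P : Finpartition s) (t : ℕ) : iterChop D P t ≤ P := by
  induction t with
  | zero => exact le_rfl
  | succ t ih => exact (chopParts_le _ _).trans ih

theorem ordConnected_of_mem_parts_iterChop {P : Finpartition s}
    (hP : ∀ A ∈ P.parts, (A : Set α).OrdConnected) (D t : ℕ) :
    ∀ A ∈ (iterChop D P t).parts, (A : Set α).OrdConnected := by
  induction t with
  | zero => exact hP
  | succ t ih => exact fun _ => ordConnected_of_mem_parts_chopParts ih

theorem card_parts_iterChop_le (D : ℕ) (P : Finpartition s) (t : ℕ) :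
    #(iterChop D P t).parts ≤ (2 * D + 1) ^ t * #P.parts := by
  induction t with
  | zero => simp [iterChop]
  | succ t ih =>
    calc #(iterChop D P (t + 1)).parts ≤ (2 * D + 1) * #(iterChop D P t).parts :=
          card_parts_chopParts_chopSize_le D _
      _ ≤ (2 * D + 1) * ((2 * D + 1) ^ t * #P.parts) := by gcongr
      _ = (2 * D + 1) ^ (t + 1) * #P.parts := by ring

/-- Only the classes of the two end points of an interval can leave it. -/
theorem card_filter_not_part_subset_le {R : Finpartition s}
    (hR : ∀ A ∈ R.parts, (A : Set α).OrdConnected) (hRm : ∀ A ∈ R.parts, #A ≤ m) {I : Finset α}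
    (hIs : I ⊆ s) (hI : (I : Set α).OrdConnected) : #{a ∈ I | ¬ R.part a ⊆ I} ≤ 2 * m := by
  rcases I.eq_empty_or_nonempty with rfl | hne
  · simp
  have hmin : I.min' hne ∈ s := hIs (I.min'_mem hne)
  have hmax : I.max' hne ∈ s := hIs (I.max'_mem hne)
  have hends : {a ∈ I | ¬ R.part a ⊆ I} ⊆ R.part (I.min' hne) ∪ R.part (I.max' hne) := by
    intro a ha
    obtain ⟨haI, hleave⟩ := mem_filter.1 ha
    obtain ⟨w, hw, hwI⟩ := not_subset.1 hleave
    have has : a ∈ s := hIs haI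
    have hconn : (R.part a : Set α).OrdConnected := hR _ (R.part_mem.2 has)
    have hw_out : w < I.min' hne ∨ I.max' hne < w := by
      by_contra! h
      exact hwI (hI.out (I.min'_mem hne) (I.max'_mem hne) h)
    rw [mem_union, R.mem_part_iff_part_eq_part has hmin, R.mem_part_iff_part_eq_part has hmax,
      eq_comm, ← R.mem_part_iff_part_eq_part hmin has, eq_comm,
      ← R.mem_part_iff_part_eq_part hmax has]
    exact hw_out.imp
      (fun h => hconn.out hw (R.mem_part has) ⟨h.le, I.min'_le a haI⟩)
      (fun h => hconn.out (R.mem_part has) hw ⟨I.le_max' a haI, h.le⟩)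
  calc #{a ∈ I | ¬ R.part a ⊆ I} ≤ #(R.part (I.min' hne)) + #(R.part (I.max' hne)) :=
        (card_le_card hends).trans (card_union_le _ _)
    _ ≤ m + m := add_le_add (hRm _ (R.part_mem.2 hmin)) (hRm _ (R.part_mem.2 hmax))
    _ = 2 * m := (two_mul m).symm

end Chop

section Regularity

variable {n : ℕ}

/-- The analogue of `maxIntervalDeviation` for a weighting `F` of the pairs of vertices, with the
mean of `F` over `A ×ˢ B` in place of the edge density. -/
noncomputable def maxIntervalDiscrepancy (F : Fin n × Fin n → ℝ) (A B : Finset (Fin n)) : ℝ :=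
  sSup {x | ∃ I J : Finset (Fin n), I ⊆ A ∧ J ⊆ B ∧ IsVertexInterval I ∧ IsVertexInterval J ∧
    x = (#I : ℝ) * (#J : ℝ) * |𝔼 e ∈ I ×ˢ J, F e - 𝔼 e ∈ A ×ˢ B, F e|}

theorem edgeDensity_eq_expect_adjMatrix {V : Type*} (G : SimpleGraph V) [DecidableRel G.Adj]
    (A B : Finset V) :
    (G.edgeDensity A B : ℝ) = 𝔼 e ∈ A ×ˢ B, G.adjMatrix ℝ e.1 e.2 := by
  simp only [SimpleGraph.adjMatrix_apply, expect_eq_sum_div_card, sum_boole, card_product,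
    SimpleGraph.edgeDensity, Rel.edgeDensity, Rel.interedges]
  push_cast
  rfl

theorem maxIntervalDeviation_eq_maxIntervalDiscrepancy (G : SimpleGraph (Fin n))
    [DecidableRel G.Adj] (A B : Finset (Fin n)) :
    maxIntervalDeviation G A B =
      maxIntervalDiscrepancy (fun e => G.adjMatrix ℝ e.1 e.2) A B := by
  simp only [maxIntervalDeviation, intervalDeviations, maxIntervalDiscrepancy,
    edgeDensity_eq_expect_adjMatrix]

theorem abs_adjMatrix_apply_le_one {V : Type*} (G : SimpleGraph V) [DecidableRel G.Adj]
    (u v : V) : |G.adjMatrix ℝ u v| ≤ 1 := by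
  rw [SimpleGraph.adjMatrix_apply]
  split_ifs <;> simp

theorem maxIntervalDiscrepancy_singleton (F : Fin n × Fin n → ℝ) (a b : Fin n) :
    maxIntervalDiscrepancy F {a} {b} = 0 := by
  refine le_antisymm (Real.sSup_nonpos ?_) (Real.sSup_nonneg ?_)
  · rintro x ⟨I, J, hI, hJ, hI', hJ', rfl⟩
    rw [hI'.1.subset_singleton_iff.1 hI, hJ'.1.subset_singleton_iff.1 hJ, sub_self, abs_zero,
      mul_zero]
  · rintro x ⟨I, J, -, -, -, -, rfl⟩
    positivity

variable {ε : ℝ} {F : Fin n × Fin n → ℝ} {P Q R : Finpartition (univ : Finset (Fin n))}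

theorem isIntervalPartition_iff :
    IsIntervalPartition P ↔ ∀ A ∈ P.parts, (A : Set (Fin n)).OrdConnected :=
  ⟨fun h A hA => (h A hA).2, fun h A hA => ⟨P.nonempty_of_mem_parts hA, h A hA⟩⟩

theorem isIntervalPartition_bot :
    IsIntervalPartition (⊥ : Finpartition (univ : Finset (Fin n))) := by
  refine isIntervalPartition_iff.2 fun A hA => ?_
  obtain ⟨a, -, rfl⟩ := Finpartition.mem_bot_iff.1 hA
  exact coe_singleton a ▸ Set.ordConnected_singleton

theorem isEpsBalanced_bot (hε : 0 ≤ ε) :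
    IsEpsBalanced ε (⊥ : Finpartition (univ : Finset (Fin n))) := by
  refine ⟨∅, empty_subset _, fun A hA B hB => ?_, by simpa using by positivity⟩
  obtain ⟨a, -, rfl⟩ := Finpartition.mem_bot_iff.1 (mem_sdiff.1 hA).1
  obtain ⟨b, -, rfl⟩ := Finpartition.mem_bot_iff.1 (mem_sdiff.1 hB).1
  simp only [card_singleton]

theorem sum_maxIntervalDiscrepancy_bot (F : Fin n × Fin n → ℝ) :
    ∑ A ∈ (⊥ : Finpartition (univ : Finset (Fin n))).parts,
      ∑ B ∈ (⊥ : Finpartition (univ : Finset (Fin n))).parts, maxIntervalDiscrepancy F A B = 0 := by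
  refine sum_eq_zero fun A hA => sum_eq_zero fun B hB => ?_
  obtain ⟨a, -, rfl⟩ := Finpartition.mem_bot_iff.1 hA
  obtain ⟨b, -, rfl⟩ := Finpartition.mem_bot_iff.1 hB
  exact maxIntervalDiscrepancy_singleton F a b

theorem isEpsBalanced_chopParts (Q : Finpartition (univ : Finset (Fin n))) {m : ℕ} (hm : 0 < m)
    (h : (#Q.parts * m : ℝ) ≤ ε * n) : IsEpsBalanced ε (chopParts Q m) := by
  have hcard : ∀ A ∈ (chopParts Q m).parts \ {C ∈ (chopParts Q m).parts | #C ≠ m}, #A = m :=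
    fun A hA => by
      obtain ⟨hAm, hA⟩ := mem_sdiff.1 hA
      exact of_not_not fun hne => hA (mem_filter.2 ⟨hAm, hne⟩)
  refine ⟨{C ∈ (chopParts Q m).parts | #C ≠ m}, filter_subset _ _,
    fun A hA B hB => (hcard A hA).trans (hcard B hB).symm, le_trans ?_ h⟩
  exact_mod_cast card_biUnion_filter_card_ne_chopParts_le Q hm

/-- The fluctuation of `F` on a box `I ×ˢ J` is seen by its average over `R`, except on those
classes of `R × R` that cross the boundary of the box. -/
theorem maxIntervalDiscrepancy_le (hF : ∀ e, |F e| ≤ 1) (hR : IsIntervalPartition R) {m : ℕ}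
    (hRm : ∀ C ∈ R.parts, #C ≤ m) {A B : Finset (Fin n)} (hA : A ∈ Q.parts) (hB : B ∈ Q.parts) :
    maxIntervalDiscrepancy F A B ≤
      ∑ e ∈ A ×ˢ B, |partAverage (productPartition R R) F e -
        partAverage (productPartition Q Q) F e| + 4 * m * (#A + #B) := by
  refine Real.sSup_le ?_ (add_nonneg (sum_nonneg fun _ _ => abs_nonneg _) (by positivity))
  rintro x ⟨I, J, hIA, hJB, hI, hJ, rfl⟩
  have hcross {I : Finset (Fin n)} (hI : IsVertexInterval I) : #{a ∈ I | ¬ R.part a ⊆ I} ≤ 2 * m :=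
    card_filter_not_part_subset_le (isIntervalPartition_iff.1 hR) hRm (subset_univ I) hI.2
  have hboundary : #{e ∈ I ×ˢ J | ¬ (productPartition R R).part e ⊆ I ×ˢ J} ≤
      2 * m * #B + #A * (2 * m) :=
    (card_filter_not_part_productPartition_subset_le R R (subset_univ I) (subset_univ J)).trans
      (add_le_add (Nat.mul_le_mul (hcross hI) (card_le_card hJB))
        (Nat.mul_le_mul (card_le_card hIA) (hcross hJ)))
  have hbox := card_mul_abs_expect_sub_expect_le (productPartition R R) (fun e _ => hF e)
    (product_mem_parts_productPartition hA hB) (product_subset_product hIA hJB)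
  rw [card_product, Nat.cast_mul] at hbox
  have hboundary' : (#{e ∈ I ×ˢ J | ¬ (productPartition R R).part e ⊆ I ×ˢ J} : ℝ) ≤
      2 * m * #B + #A * (2 * m) := mod_cast hboundary
  linarith

theorem sum_maxIntervalDiscrepancy_le (hF : ∀ e, |F e| ≤ 1) (hR : IsIntervalPartition R) {m : ℕ}
    (hRm : ∀ C ∈ R.parts, #C ≤ m) (Q : Finpartition (univ : Finset (Fin n))) :
    ∑ A ∈ Q.parts, ∑ B ∈ Q.parts, maxIntervalDiscrepancy F A B ≤
      ∑ e ∈ univ ×ˢ univ, |partAverage (productPartition R R) F e -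
        partAverage (productPartition Q Q) F e| + 8 * (#Q.parts * m) * n := by
  have hcard : ∑ A ∈ Q.parts, (#A : ℝ) = n := by
    rw [← Nat.cast_sum, Q.sum_card_parts, card_univ, Fintype.card_fin]
  calc _ ≤ ∑ A ∈ Q.parts, ∑ B ∈ Q.parts, (∑ e ∈ A ×ˢ B, |partAverage (productPartition R R) F e -
          partAverage (productPartition Q Q) F e| + 4 * m * (#A + #B)) :=
        sum_le_sum fun A hA => sum_le_sum fun B hB => maxIntervalDiscrepancy_le hF hR hRm hA hB
    _ = _ := by
        simp only [sum_add_distrib, sum_const, nsmul_eq_mul, ← mul_sum,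
          sum_parts_sum_parts_sum_product, hcard]
        ring

theorem chopSize_pos (hn : 0 < n) {D : ℕ} (hD : 0 < D) (hQ : D * #Q.parts ≤ n) :
    0 < chopSize D Q := by
  have hne : (univ : Finset (Fin n)) ≠ ⊥ := ne_empty_of_mem (mem_univ ⟨0, hn⟩)
  rw [chopSize, card_univ, Fintype.card_fin]
  exact Nat.div_pos hQ (Nat.mul_pos hD (Q.parts_nonempty hne).card_pos)

theorem card_parts_mul_chopSize_le (D : ℕ) (Q : Finpartition (univ : Finset (Fin n))) :
    (#Q.parts * chopSize D Q : ℝ) ≤ n / D := by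
  rcases D.eq_zero_or_pos with rfl | hD
  · simp [chopSize]
  rw [le_div_iff₀ (by exact_mod_cast hD)]
  have h := card_parts_mul_chopSize_mul_le D Q
  rw [card_univ, Fintype.card_fin] at h
  exact_mod_cast h

theorem sum_maxIntervalDiscrepancy_le_of_partEnergy_sub_le (hF : ∀ e, |F e| ≤ 1)
    (hQ : IsIntervalPartition Q) {D : ℕ} (hQm : 0 < chopSize D Q) {η : ℝ} (hη : 0 ≤ η)
    (hE : partEnergy (productPartition (chopParts Q (chopSize D Q))
      (chopParts Q (chopSize D Q))) F - partEnergy (productPartition Q Q) F ≤ η ^ 2 * n ^ 2) :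
    ∑ A ∈ Q.parts, ∑ B ∈ Q.parts, maxIntervalDiscrepancy F A B ≤ (η + 8 / D) * n ^ 2 := by
  set R := chopParts Q (chopSize D Q)
  have hR : IsIntervalPartition R := isIntervalPartition_iff.2 fun C =>
    ordConnected_of_mem_parts_chopParts (isIntervalPartition_iff.1 hQ)
  have hRQ : productPartition R R ≤ productPartition Q Q :=
    productPartition_mono (chopParts_le _ _) (chopParts_le _ _)
  have hcard : (#((univ : Finset (Fin n)) ×ˢ (univ : Finset (Fin n))) : ℝ) = n ^ 2 := by
    simp [sq]
  have hL1 := sum_abs_partAverage_sub_le hRQ hη (hcard ▸ hE)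
  calc _ ≤ _ := sum_maxIntervalDiscrepancy_le hF hR
        (fun C => card_le_of_mem_parts_chopParts hQm) Q
    _ ≤ η * n ^ 2 + 8 * (n / D) * n := by
        rw [hcard] at hL1
        gcongr
        exact card_parts_mul_chopSize_le D Q
    _ = (η + 8 / D) * n ^ 2 := by ring

theorem exists_succ_sub_le_div {E : ℕ → ℝ} {B : ℝ} {T : ℕ} (hT : 0 < T) (h0 : 0 ≤ E 0)
    (hB : E T ≤ B) : ∃ t < T, E (t + 1) - E t ≤ B / T := by
  have hT' : (T : ℝ) ≠ 0 := by exact_mod_cast hT.ne'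
  obtain ⟨t, ht, h⟩ : ∃ t ∈ range T, E (t + 1) - E t ≤ B / T := by
    refine exists_le_of_sum_le (nonempty_range_iff.2 hT.ne') ?_
    rw [sum_range_sub, sum_const, card_range, nsmul_eq_mul, mul_div_cancel₀ _ hT']
    linarith
  exact ⟨t, mem_range.1 ht, h⟩

theorem isIntervalPartition_iterChop (hP : IsIntervalPartition P) (D t : ℕ) :
    IsIntervalPartition (iterChop D P t) :=
  isIntervalPartition_iff.2 (ordConnected_of_mem_parts_iterChop (isIntervalPartition_iff.1 hP) D t)

/-- The energies lie between `0` and `n ^ 2`, so one of `D ^ 2` consecutive refinement steps raises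
the energy by at most `(n / D) ^ 2`. -/
theorem exists_lt_sum_maxIntervalDiscrepancy_iterChop_le (hF : ∀ e, |F e| ≤ 1)
    (hP : IsIntervalPartition P) {D : ℕ} (hD : 0 < D)
    (hsize : ∀ t ≤ D ^ 2, 0 < chopSize D (iterChop D P t)) :
    ∃ t < D ^ 2, ∑ A ∈ (iterChop D P (t + 1)).parts, ∑ B ∈ (iterChop D P (t + 1)).parts,
      maxIntervalDiscrepancy F A B ≤ 9 / D * n ^ 2 := by
  set E : ℕ → ℝ := fun t =>
    partEnergy (productPartition (iterChop D P (t + 1)) (iterChop D P (t + 1))) F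
  have hE : E (D ^ 2) ≤ n ^ 2 :=
    (partEnergy_le _ fun e _ => hF e).trans_eq (by simp [sq])
  obtain ⟨t, ht, hincr⟩ :=
    exists_succ_sub_le_div (by positivity) (partEnergy_nonneg _ _ : 0 ≤ E 0) hE
  refine ⟨t, ht, (sum_maxIntervalDiscrepancy_le_of_partEnergy_sub_le hF
    (isIntervalPartition_iterChop hP D _) (hsize _ ht) (η := 1 / D) (by positivity)
    (hincr.trans_eq ?_)).trans_eq ?_⟩
  · push_cast
    ring
  · ring

theorem chopSize_iterChop_pos (hn : 0 < n) {D : ℕ} (hD : 0 < D) {t T : ℕ} (ht : t ≤ T)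
    (hsize : D * ((2 * D + 1) ^ T * #P.parts) ≤ n) : 0 < chopSize D (iterChop D P t) := by
  refine chopSize_pos hn hD (le_trans ?_ hsize)
  calc D * #(iterChop D P t).parts ≤ D * ((2 * D + 1) ^ t * #P.parts) := by
        gcongr
        exact card_parts_iterChop_le D P t
    _ ≤ D * ((2 * D + 1) ^ T * #P.parts) := by gcongr; omega

end Regularity

theorem mainTheorem3_general (ε : ℝ) (hε : 0 < ε) (p : ℕ) :
    ∃ k : ℕ, ∀ n : ℕ, 0 < n → ∀ F : Fin n × Fin n → ℝ, (∀ e, |F e| ≤ 1) →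
      ∀ P : Finpartition (univ : Finset (Fin n)), IsIntervalPartition P → #P.parts ≤ p →
      ∃ Q : Finpartition (univ : Finset (Fin n)),
        Q ≤ P ∧ IsIntervalPartition Q ∧ #Q.parts ≤ k ∧ IsEpsBalanced ε Q ∧
        ∑ A ∈ Q.parts, ∑ B ∈ Q.parts, maxIntervalDiscrepancy F A B < ε * (n : ℝ) ^ 2 := by
  obtain ⟨D, hDε⟩ := exists_nat_gt (9 / ε)
  have hD : 0 < D := Nat.cast_pos.1 ((by positivity : 0 < 9 / ε).trans hDε)
  have hDε' : (9 / D : ℝ) < ε := (div_lt_comm₀ hε (by positivity)).1 hDε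
  refine ⟨D * ((2 * D + 1) ^ D ^ 2 * p), fun n hn F hF P hP hPp => ?_⟩
  rcases lt_or_ge n (D * ((2 * D + 1) ^ D ^ 2 * p)) with hsmall | hlarge
  · refine ⟨⊥, bot_le, isIntervalPartition_bot, ?_, isEpsBalanced_bot hε.le, ?_⟩
    · simpa using hsmall.le
    · rw [sum_maxIntervalDiscrepancy_bot]
      positivity
  have hsize : ∀ t ≤ D ^ 2, 0 < chopSize D (iterChop D P t) := fun t ht =>
    chopSize_iterChop_pos hn hD ht (le_trans (by gcongr) hlarge)
  obtain ⟨t, ht, hsum⟩ := exists_lt_sum_maxIntervalDiscrepancy_iterChop_le hF hP hD hsize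
  refine ⟨iterChop D P (t + 1), iterChop_le D P _, isIntervalPartition_iterChop hP D _,
    ?_, isEpsBalanced_chopParts _ (hsize t ht.le) ?_, hsum.trans_lt (by gcongr)⟩
  · calc #(iterChop D P (t + 1)).parts ≤ (2 * D + 1) ^ (t + 1) * #P.parts :=
          card_parts_iterChop_le D P _
      _ ≤ (2 * D + 1) ^ D ^ 2 * p := by gcongr <;> omega
      _ ≤ D * ((2 * D + 1) ^ D ^ 2 * p) := Nat.le_mul_of_pos_left _ hD
  · calc (#(iterChop D P t).parts * chopSize D (iterChop D P t) : ℝ) ≤ n / D :=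
          card_parts_mul_chopSize_le D _
      _ ≤ 9 / D * n := by rw [div_mul_eq_mul_div]; gcongr; linarith [n.cast_nonneg (α := ℝ)]
      _ ≤ ε * n := by gcongr

theorem mainTheorem3 (ε : ℝ) (hε : 0 < ε) (p : ℕ) :
    ∃ k : ℕ, ∀ n : ℕ, 0 < n → ∀ (G : SimpleGraph (Fin n)) [DecidableRel G.Adj]
      (P : Finpartition (Finset.univ : Finset (Fin n))),
      IsIntervalPartition P → P.parts.card ≤ p →
      ∃ Q : Finpartition (Finset.univ : Finset (Fin n)),
        Q ≤ P ∧ IsIntervalPartition Q ∧ Q.parts.card ≤ k ∧ IsEpsBalanced ε Q ∧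
        ∑ A ∈ Q.parts, ∑ B ∈ Q.parts, maxIntervalDeviation G A B < ε * (n : ℝ) ^ 2 := by
  obtain ⟨k, hk⟩ := mainTheorem3_general ε hε p
  refine ⟨k, fun n hn G _ P hP hPp => ?_⟩
  simpa only [maxIntervalDeviation_eq_maxIntervalDiscrepancy] using
    hk n hn _ (fun e => abs_adjMatrix_apply_le_one G e.1 e.2) P hP hPp
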